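/- Let $\Omega$ be an infinite set, let $G\le\mathrm{Sym}(\Omega)$ be a group all of whose infinite normal subgroups are transitive on $\Omega$, let $\alpha\in\Omega$, and suppose that the stabiliser $H:=G_\alpha$ satisfies the minimal condition on normal subgroups (every non-empty set of normal subgroups of $H$ has a minimal member). Suppose that $G$ has arbitrarily large finite normal subgroups. Then $G$ has a unique minimal infinite normal subgroup $M$ (a minimal member of the set of infinite normal subgroups of $G$), and $M$ acts regularly on $\Omega$. For some prime number $p$ and some integer $r\ge 0$, $M$ is a divisible abelian $p$-group of finite rank $r$, where the rank is that of the elementary abelian group $M[p]=\{x\in M : x^p=1\}$, i.e. $|M[p]|=p^r$. Moreover, $H$ is finite, and it acts by conjugation on $M$ faithfully and $p$-adic irreducibly in the following sense: $M$ is isomorphic to $(C_{p^\infty})^r$, where $C_{p^\infty}\cong\mathbb{Q}_p/\mathbb{Z}_p$ is the Prüfer $p$-group, and, for every isomorphism $M\cong(\mathbb{Q}_p/\mathbb{Z}_p)^r$, the action of $H$ on $M$ is given in these coordinates by a homomorphism $H\to\mathrm{GL}(r,\mathbb{Z}_p)$ (matrices over the $p$-adic integers acting on $(\mathbb{Q}_p/\mathbb{Z}_p)^r$),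 and the resulting representation $H\to\mathrm{GL}(r,\mathbb{Z}_p)\le\mathrm{GL}(r,\mathbb{Q}_p)$ on $\mathbb{Q}_p^r$ is irreducible. -/

import Mathlib

/-- The minimal condition on normal subgroups: every non-empty set of normal subgroups of `X`
has a minimal member. -/
def MinN (X : Type*) [Group X] : Prop :=
  ∀ S : Set (Subgroup X), S.Nonempty → (∀ N ∈ S, N.Normal) → ∃ N, Minimal (fun K => K ∈ S) N

/-- `N` is an infinite normal subgroup of `X`. -/
def IsInfiniteNormal {X : Type*} [Group X] (N : Subgroup X) : Prop :=
  N.Normal ∧ Infinite N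

/-- `X` has arbitrarily large finite normal subgroups. -/
def HasLargeFiniteNormal (X : Type*) [Group X] : Prop :=
  ∀ n : ℕ, ∃ N : Subgroup X, N.Normal ∧ Finite N ∧ n ≤ Nat.card N

/-- The action of `X` on `Ω` is regular, that is, sharply transitive. -/
def ActsRegularly (X Ω : Type*) [Group X] [MulAction X Ω] : Prop :=
  ∀ a b : Ω, ∃! x : X, x • a = b

/-- `X` is a divisible abelian `p`-group of rank `r`; the rank is that of the elementary abelian
group `X[p] = {x | x ^ p = 1}`, which has rank `r` when its order is `p ^ r`. -/
structure IsDivisibleAbelianPGroup (p r : ℕ) (X : Type*) [Group X] : Prop where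
  comm : ∀ x y : X, x * y = y * x
  isPGroup : IsPGroup p X
  divisible : ∀ n : ℕ, n ≠ 0 → ∀ x : X, ∃ y : X, y ^ n = x
  rank_eq : Nat.card {x : X // x ^ p = 1} = p ^ r

/-- The Prüfer `p`-group `C_{p^∞}`, as the `ℤ_p`-module `ℚ_p / ℤ_p`. -/
abbrev PruferGroup (p : ℕ) [Fact p.Prime] : Type :=
  ℚ_[p] ⧸ LinearMap.range (Algebra.linearMap ℤ_[p] ℚ_[p])

/-- In the coordinates `e : M ≃ (C_{p^∞})^r`, the automorphism `f` of `M` is given by the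
`r × r` matrix `A` of `p`-adic integers. -/
def IsMatrixOf {p : ℕ} [Fact p.Prime] {r : ℕ} {M : Type*} [Group M]
    (e : Additive M ≃+ (Fin r → PruferGroup p)) (f : MulAut M)
    (A : Matrix (Fin r) (Fin r) ℤ_[p]) : Prop :=
  ∀ (x : M) (i : Fin r),
    e (Additive.ofMul (f x)) i = ∑ j : Fin r, A i j • e (Additive.ofMul x) j

/-- The representation on `ℚ_p ^ r` obtained from a homomorphism to `GL(r, ℤ_p)` through the
inclusion of `GL(r, ℤ_p)` in `GL(r, ℚ_p)`. -/
noncomputable def padicRepresentation {p : ℕ} [Fact p.Prime] {r : ℕ} {H : Type*} [Group H]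
    (ρ : H →* Matrix.GeneralLinearGroup (Fin r) ℤ_[p]) :
    Representation ℚ_[p] H (Fin r → ℚ_[p]) :=
  ((Matrix.toLinAlgEquiv' : Matrix (Fin r) (Fin r) ℚ_[p] ≃ₐ[ℚ_[p]] _) :
      Matrix (Fin r) (Fin r) ℚ_[p] →* Module.End ℚ_[p] (Fin r → ℚ_[p])).comp
    ((Units.coeHom (Matrix (Fin r) (Fin r) ℚ_[p])).comp
      ((Matrix.GeneralLinearGroup.map (algebraMap ℤ_[p] ℚ_[p])).comp ρ))

/-- `H`, acting through `φ` by automorphisms on a group `M` isomorphic to `(C_{p^∞})^r`, acts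
`p`-adic irreducibly: under the identification of `Aut M` with `GL(r, ℤ_p)` given by any
decomposition of `M` as a direct sum of `r` copies of `C_{p^∞}`, the group `H` is irreducible on
`ℚ_p ^ r`. -/
def IsPAdicIrreducible (p : ℕ) [Fact p.Prime] (r : ℕ) {H M : Type*} [Group H] [Group M]
    (φ : H →* MulAut M) : Prop :=
  Nonempty (Additive M ≃+ (Fin r → PruferGroup p)) ∧
    ∀ e : Additive M ≃+ (Fin r → PruferGroup p),
      ∃ ρ : H →* Matrix.GeneralLinearGroup (Fin r) ℤ_[p],
        (∀ h : H, IsMatrixOf e (φ h) (ρ h : Matrix (Fin r) (Fin r) ℤ_[p])) ∧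
          (padicRepresentation ρ).IsIrreducible

/-! Every infinite normal subgroup `N` is transitive, so `G = N H`, and infinite normal subgroups
below a given one are told apart by their traces on `H`. The minimal condition thus gives a minimal
infinite normal `M` inside the union of the finite normal subgroups. Finite normal subgroups have
centralisers of finite index, so minimality makes `M` abelian, hence regular; the minimal condition
on the traces of these centralisers makes `H` finite. Then `M` has finite index, which yields
uniqueness and excludes prime exponent. Since characteristic subgroups of `M` are finite or `M`, it
is a divisible `p`-group of finite rank (`exists_isDivisibleAbelianPGroup`), so a power of `ℚ_p /
ℤ_p`, whose endomorphisms are `p`-adic matrices. As `M` is abelian, `H`-invariant subgroups of `M`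
are normal in `G`, so finite or `M`. An invariant subspace of `ℚ_p ^ r` projects to such a subgroup
and is accordingly zero or everything (`padicRepresentation_isIrreducible`). -/

/-! ### The Prüfer group: torsion and endomorphisms. -/

namespace PruferGroup

variable {p : ℕ} [Fact p.Prime]

/-- The class of `1 / p ^ n` in `ℚ_p / ℤ_p`. -/
noncomputable def gen (p : ℕ) [Fact p.Prime] (n : ℕ) : PruferGroup p :=
  Submodule.Quotient.mk (((p : ℚ_[p]) ^ n)⁻¹)

theorem mk_eq_zero_iff (x : ℚ_[p]) :
    (Submodule.Quotient.mk x : PruferGroup p) = 0 ↔ ‖x‖ ≤ 1 := by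
  rw [Submodule.Quotient.mk_eq_zero, LinearMap.mem_range]
  constructor
  · rintro ⟨y, rfl⟩
    exact y.2
  · intro h
    exact ⟨⟨x, h⟩, rfl⟩

theorem cast_p_ne_zero : (p : ℚ_[p]) ≠ 0 :=
  Nat.cast_ne_zero.2 (Fact.out : p.Prime).ne_zero

theorem smul_gen (a : ℤ_[p]) (n : ℕ) :
    a • gen p n = Submodule.Quotient.mk ((a : ℚ_[p]) * ((p : ℚ_[p]) ^ n)⁻¹) := by
  rw [gen, ← Submodule.Quotient.mk_smul]
  rfl

theorem smul_gen_eq_zero_iff (a : ℤ_[p]) (n : ℕ) :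
    a • gen p n = 0 ↔ a ∈ (Ideal.span {(p : ℤ_[p]) ^ n} : Ideal ℤ_[p]) := by
  rw [smul_gen, mk_eq_zero_iff, ← PadicInt.norm_le_pow_iff_mem_span_pow, norm_mul, norm_inv,
    norm_pow, Padic.norm_p, PadicInt.norm_def, inv_pow, inv_inv]
  have hp : (0 : ℝ) < (p : ℝ) ^ n := by
    have := (Fact.out : p.Prime).pos
    positivity
  rw [zpow_neg, zpow_natCast, ← one_div, le_div_iff₀ hp]

theorem pow_smul_gen (m n : ℕ) : p ^ n • gen p (m + n) = gen p m := by
  rw [← Nat.cast_smul_eq_nsmul ℤ_[p], smul_gen, gen]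
  congr 1
  have := cast_p_ne_zero (p := p)
  push_cast
  field_simp
  rw [pow_add, mul_comm]

theorem pow_smul_gen_self (n : ℕ) : p ^ n • gen p n = 0 := by
  rw [← Nat.cast_smul_eq_nsmul ℤ_[p], smul_gen_eq_zero_iff]
  push_cast
  exact Ideal.mem_span_singleton_self _

theorem exists_eq_smul_gen {n : ℕ} {x : PruferGroup p} (hx : p ^ n • x = 0) :
    ∃ a : ℤ_[p], x = a • gen p n := by
  obtain ⟨q, rfl⟩ := Submodule.Quotient.mk_surjective _ x
  rw [← Submodule.Quotient.mk_smul, mk_eq_zero_iff] at hx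
  obtain ⟨a, ha⟩ : ∃ a : ℤ_[p], (a : ℚ_[p]) = p ^ n • q := ⟨⟨_, hx⟩, rfl⟩
  refine ⟨a, ?_⟩
  rw [smul_gen, ha]
  congr 1
  have := cast_p_ne_zero (p := p)
  simp only [nsmul_eq_mul]
  push_cast
  field_simp

theorem smul_gen_eq_nsmul (a : ℤ_[p]) (n : ℕ) : a • gen p n = a.appr n • gen p n := by
  rw [← Nat.cast_smul_eq_nsmul ℤ_[p], ← sub_eq_zero, ← sub_smul, smul_gen_eq_zero_iff]
  exact PadicInt.appr_spec n a

theorem exists_pow_smul_eq_zero (x : PruferGroup p) : ∃ n : ℕ, p ^ n • x = 0 := by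
  obtain ⟨q, rfl⟩ := Submodule.Quotient.mk_surjective _ x
  obtain ⟨n, hn⟩ := pow_unbounded_of_one_lt ‖q‖
    (show (1 : ℝ) < p from Nat.one_lt_cast.2 (Fact.out : p.Prime).one_lt)
  refine ⟨n, ?_⟩
  rw [← Submodule.Quotient.mk_smul, mk_eq_zero_iff, nsmul_eq_mul, norm_mul]
  push_cast
  rw [norm_pow, Padic.norm_p, inv_pow]
  have hp : (0 : ℝ) < (p : ℝ) ^ n := by
    have := (Fact.out : p.Prime).pos
    positivity
  rw [inv_mul_le_iff₀ hp]
  simpa using hn.le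

theorem exists_eq_nsmul_gen (x : PruferGroup p) : ∃ k n : ℕ, x = k • gen p n := by
  obtain ⟨n, hn⟩ := exists_pow_smul_eq_zero x
  obtain ⟨a, rfl⟩ := exists_eq_smul_gen hn
  exact ⟨_, n, smul_gen_eq_nsmul a n⟩

theorem exists_nsmul_eq {n : ℕ} (hn : n ≠ 0) (x : PruferGroup p) : ∃ y, n • y = x := by
  obtain ⟨q, rfl⟩ := Submodule.Quotient.mk_surjective _ x
  refine ⟨Submodule.Quotient.mk (q / n), ?_⟩
  rw [← Submodule.Quotient.mk_smul]
  congr 1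
  have : (n : ℚ_[p]) ≠ 0 := Nat.cast_ne_zero.2 hn
  simp only [nsmul_eq_mul]
  field_simp

theorem eq_of_forall_smul_eq {a b : ℤ_[p]} (h : ∀ x : PruferGroup p, a • x = b • x) : a = b := by
  rw [← sub_eq_zero]
  apply IsHausdorff.haus (I := IsLocalRing.maximalIdeal ℤ_[p]) inferInstance
  intro n
  rw [SModEq.zero, smul_eq_mul, Ideal.mul_top, PadicInt.maximalIdeal_eq_span_p,
    Ideal.span_singleton_pow, ← smul_gen_eq_zero_iff, sub_smul, h, sub_self]

/-- On the `p ^ n`-torsion, generated over `ℤ_p` by `gen p n`, `f` is a scalar modulo `p ^ n`. These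
scalars are compatible, and completeness of `ℤ_p` supplies their limit. -/
theorem exists_addMonoidHom_eq_smul (f : PruferGroup p →+ PruferGroup p) :
    ∃ a : ℤ_[p], ∀ x, f x = a • x := by
  have h (n : ℕ) : ∃ a : ℤ_[p], f (gen p n) = a • gen p n := by
    apply exists_eq_smul_gen
    rw [← map_nsmul, pow_smul_gen_self, map_zero]
  choose a ha using h
  obtain ⟨L, hL⟩ := IsPrecomplete.prec (I := IsLocalRing.maximalIdeal ℤ_[p]) inferInstance
    (f := a) (by
      intro m n hmn
      rw [SModEq.sub_mem, smul_eq_mul, Ideal.mul_top, PadicInt.maximalIdeal_eq_span_p,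
        Ideal.span_singleton_pow, ← smul_gen_eq_zero_iff, sub_smul, sub_eq_zero]
      obtain ⟨k, rfl⟩ := Nat.exists_eq_add_of_le hmn
      rw [← ha, ← pow_smul_gen m k, map_nsmul, ha, smul_comm])
  refine ⟨L, fun x ↦ ?_⟩
  obtain ⟨k, n, rfl⟩ := exists_eq_nsmul_gen x
  have := hL n
  rw [SModEq.sub_mem, smul_eq_mul, Ideal.mul_top, PadicInt.maximalIdeal_eq_span_p,
    Ideal.span_singleton_pow, ← smul_gen_eq_zero_iff, sub_smul, sub_eq_zero] at this
  rw [map_nsmul, ha, this, smul_comm]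

/-- The map `a ↦ a • gen p 1` sends `ℤ_p` onto the `p`-torsion with kernel `p ℤ_p`, so the count is
that of the residue field. -/
theorem natCard_torsion : Nat.card {x : PruferGroup p // p • x = 0} = p := by
  let g : ℤ_[p] →+ PruferGroup p := (LinearMap.toSpanSingleton ℤ_[p] _ (gen p 1)).toAddMonoidHom
  have hker : g.ker = (PadicInt.toZMod (p := p)).toAddMonoidHom.ker := by
    ext a
    have := SetLike.ext_iff.1 (PadicInt.ker_toZMod (p := p)) a
    rw [PadicInt.maximalIdeal_eq_span_p, RingHom.mem_ker] at this
    refine Iff.trans ?_ this.symm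
    have := smul_gen_eq_zero_iff a 1
    rwa [pow_one] at this
  have h1 : Nat.card g.range = p := by
    rw [← Nat.card_congr (QuotientAddGroup.quotientKerEquivRange g).toEquiv, hker,
      Nat.card_congr (QuotientAddGroup.quotientKerEquivOfSurjective
        (PadicInt.toZMod (p := p)).toAddMonoidHom (ZMod.ringHom_surjective _)).toEquiv,
      Nat.card_zmod]
  refine Eq.trans ?_ h1
  refine Nat.card_congr (Equiv.subtypeEquivRight fun x ↦ ?_)
  rw [AddMonoidHom.mem_range]
  constructor
  · intro hx
    obtain ⟨a, rfl⟩ := exists_eq_smul_gen (n := 1) (by rwa [pow_one])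
    exact ⟨a, rfl⟩
  · rintro ⟨a, rfl⟩
    change p • a • gen p 1 = 0
    rw [smul_comm]
    have := pow_smul_gen_self (p := p) 1
    rw [pow_one] at this
    rw [this, smul_zero]

end PruferGroup

/-! ### Divisible abelian `p`-groups are determined by their `p`-torsion. -/

theorem nonempty_addEquiv_of_zmod_module (p : ℕ) [Fact p.Prime] {A B : Type*}
    [AddCommGroup A] [AddCommGroup B] [Finite A] [Finite B] [Module (ZMod p) A]
    [Module (ZMod p) B] (hcard : Nat.card A = Nat.card B) : Nonempty (A ≃+ B) := by
  rw [← FiniteField.pow_finrank_eq_natCard p A, ← FiniteField.pow_finrank_eq_natCard p B] at hcard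
  have hr : Module.finrank (ZMod p) A = Module.finrank (ZMod p) B :=
    Nat.pow_right_injective (Fact.out : p.Prime).two_le hcard
  exact (FiniteDimensional.nonempty_linearEquiv_of_finrank_eq hr).map LinearEquiv.toAddEquiv

theorem nonempty_addEquiv_of_smul_eq_zero {p : ℕ} [Fact p.Prime] {A B : Type*}
    [AddCommGroup A] [AddCommGroup B] [Finite A] [Finite B] (hA : ∀ x : A, p • x = 0)
    (hB : ∀ x : B, p • x = 0) (hcard : Nat.card A = Nat.card B) : Nonempty (A ≃+ B) :=
  let := AddCommGroup.zmodModule hA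
  let := AddCommGroup.zmodModule hB
  nonempty_addEquiv_of_zmod_module p hcard

/-- Divisible groups are injective, so an isomorphism of the `p`-torsion subgroups extends to `A`.
Both bijectivity claims go by induction on the exponent `n` of an element. -/
theorem nonempty_addEquiv_of_card_torsion_eq {p : ℕ} [Fact p.Prime] {A B : Type*}
    [AddCommGroup A] [AddCommGroup B] (hA : ∀ n : ℕ, n ≠ 0 → ∀ x : A, ∃ y, n • y = x)
    (hB : ∀ n : ℕ, n ≠ 0 → ∀ x : B, ∃ y, n • y = x)
    (hpA : ∀ x : A, ∃ n : ℕ, p ^ n • x = 0) (hpB : ∀ x : B, ∃ n : ℕ, p ^ n • x = 0)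
    [Finite {x : A // p • x = 0}]
    (h : Nat.card {x : A // p • x = 0} = Nat.card {x : B // p • x = 0}) :
    Nonempty (A ≃+ B) := by
  have hp : p.Prime := Fact.out
  let TA := (nsmulAddMonoidHom p : A →+ A).ker
  let TB := (nsmulAddMonoidHom p : B →+ B).ker
  have hfA : Finite TA := ‹Finite {x : A // p • x = 0}›
  have hcard : Nat.card TA = Nat.card TB := h
  have hfB : Finite TB := Nat.finite_of_card_ne_zero (hcard ▸ Nat.card_pos.ne')
  obtain ⟨φ⟩ := nonempty_addEquiv_of_smul_eq_zero (A := TA) (B := TB) (p := p)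
    (fun x ↦ Subtype.ext x.2) (fun x ↦ Subtype.ext x.2) hcard
  let : DivisibleBy B ℕ := divisibleByOfSMulRightSurj B ℕ
    fun {n} hn x ↦ hB n hn x
  let : DivisibleBy B ℤ := AddGroup.divisibleByIntOfDivisibleByNat B
  obtain ⟨f, hf⟩ := (Module.Baer.of_divisible B).extension_property_addMonoidHom
    TA.subtype Subtype.val_injective (TB.subtype.comp φ.toAddMonoidHom)
  have hf' (x : TA) : f x = φ x := DFunLike.congr_fun hf x
  have hinj : Function.Injective f := by
    rw [injective_iff_map_eq_zero]
    intro x hx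
    obtain ⟨n, hn⟩ := hpA x
    induction n generalizing x with
    | zero => simpa using hn
    | succ n ih =>
      have hpx : p • x = 0 := by
        refine ih _ (by rw [map_nsmul, hx, smul_zero]) ?_
        rw [← mul_smul, ← pow_succ, hn]
      have h2 := hf' ⟨x, hpx⟩
      change f x = _ at h2
      rw [hx] at h2
      have h3 : φ ⟨x, hpx⟩ = 0 := Subtype.ext h2.symm
      rw [EmbeddingLike.map_eq_zero_iff] at h3
      exact congrArg Subtype.val h3
  have hsurj : Function.Surjective f := by
    intro x
    obtain ⟨n, hn⟩ := hpB x
    induction n generalizing x with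
    | zero => exact ⟨0, by simpa using hn.symm⟩
    | succ n ih =>
      obtain ⟨y, hy⟩ := ih (p • x) (by rw [← mul_smul, ← pow_succ, hn])
      obtain ⟨z, rfl⟩ := hA p hp.ne_zero y
      have hz : p • (x - f z) = 0 := by rw [smul_sub, ← map_nsmul, hy, sub_self]
      -- `f z` is correct up to `p`-torsion, where `φ` can be inverted.
      refine ⟨z + φ.symm ⟨x - f z, hz⟩, ?_⟩
      rw [map_add, hf', AddEquiv.apply_symm_apply]
      exact add_sub_cancel _ _
  exact ⟨AddEquiv.ofBijective f ⟨hinj, hsurj⟩⟩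

/-! ### Powers of the Prüfer group and `p`-adic matrices. -/

namespace PruferGroup

variable {p : ℕ} [Fact p.Prime] {r : ℕ}

theorem natCard_pi_torsion :
    Nat.card {x : Fin r → PruferGroup p // p • x = 0} = p ^ r := by
  have e : {x : Fin r → PruferGroup p // p • x = 0} ≃
      (Fin r → {x : PruferGroup p // p • x = 0}) :=
    (Equiv.subtypeEquivRight fun x ↦ by rw [funext_iff]; rfl).trans
      (Equiv.subtypePiEquivPi (p := fun _ (x : PruferGroup p) ↦ p • x = 0))
  rw [Nat.card_congr e, Nat.card_pi, Finset.prod_const, Finset.card_univ, Fintype.card_fin,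
    natCard_torsion]

theorem pi_exists_pow_smul_eq_zero (x : Fin r → PruferGroup p) : ∃ n : ℕ, p ^ n • x = 0 := by
  choose n hn using fun i ↦ exists_pow_smul_eq_zero (x i)
  refine ⟨∑ i, n i, funext fun i ↦ ?_⟩
  rw [Pi.smul_apply, ← Finset.add_sum_erase _ _ (Finset.mem_univ i), pow_add, mul_comm, mul_smul,
    hn, smul_zero, Pi.zero_apply]

theorem pi_exists_nsmul_eq {n : ℕ} (hn : n ≠ 0) (x : Fin r → PruferGroup p) :
    ∃ y, n • y = x := by
  choose y hy using fun i ↦ exists_nsmul_eq hn (x i)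
  exact ⟨y, funext hy⟩

theorem exists_matrix (f : (Fin r → PruferGroup p) →+ (Fin r → PruferGroup p)) :
    ∃ A : Matrix (Fin r) (Fin r) ℤ_[p], ∀ x i, f x i = ∑ j, A i j • x j := by
  choose A hA using fun i j ↦ exists_addMonoidHom_eq_smul
    (((Pi.evalAddMonoidHom _ i).comp f).comp (AddMonoidHom.single (fun _ ↦ PruferGroup p) j))
  refine ⟨A, fun x i ↦ ?_⟩
  simp_rw [← hA]
  conv_lhs => rw [← Finset.univ_sum_single x, map_sum, Finset.sum_apply]
  rfl

theorem matrix_ext {A B : Matrix (Fin r) (Fin r) ℤ_[p]}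
    (h : ∀ (x : Fin r → PruferGroup p) i, ∑ j, A i j • x j = ∑ j, B i j • x j) : A = B := by
  ext i j : 1
  refine eq_of_forall_smul_eq fun x ↦ ?_
  simpa [Pi.single_apply] using h (Pi.single j x) i

end PruferGroup

/-- In coordinates, an action on `(ℚ_p / ℤ_p) ^ r` is given by matrices of `p`-adic integers. -/
theorem exists_hom_isMatrixOf {p : ℕ} [Fact p.Prime] {r : ℕ} {H M : Type*} [Group H] [Group M]
    (φ : H →* MulAut M) (e : Additive M ≃+ (Fin r → PruferGroup p)) :
    ∃ ρ : H →* Matrix.GeneralLinearGroup (Fin r) ℤ_[p],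
      ∀ h : H, IsMatrixOf e (φ h) (ρ h : Matrix (Fin r) (Fin r) ℤ_[p]) := by
  have hA (h : H) : ∃ A : Matrix (Fin r) (Fin r) ℤ_[p], ∀ x i,
      e (Additive.ofMul (φ h (e.symm x).toMul)) i = ∑ j, A i j • x j :=
    PruferGroup.exists_matrix (e.toAddMonoidHom.comp
      ((MonoidHom.toAdditive (φ h).toMonoidHom).comp e.symm.toAddMonoidHom))
  choose A hA using hA
  have hA' (h : H) (x : M) (i : Fin r) : e (Additive.ofMul (φ h x)) i =
      ∑ j, A h i j • e (Additive.ofMul x) j := by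
    rw [← hA, e.symm_apply_apply, toMul_ofMul]
  let f : H →* Matrix (Fin r) (Fin r) ℤ_[p] :=
    { toFun := A
      map_one' := by
        refine PruferGroup.matrix_ext fun x i ↦ ?_
        rw [← hA]
        simp [Matrix.one_apply]
      map_mul' := fun g h ↦ by
        refine PruferGroup.matrix_ext fun x i ↦ ?_
        rw [← hA, map_mul, MulAut.mul_apply, hA']
        simp_rw [hA, Matrix.mul_apply, Finset.sum_smul, Finset.smul_sum, mul_smul]
        exact Finset.sum_comm }
  -- `H` is a group, so its image consists of invertible matrices.
  exact ⟨f.toHomUnits, hA'⟩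

/-! ### Finite normal subgroups and minimal infinite ones. -/

section FiniteIndex

variable {G : Type*} [Group G]

theorem infinite_inf_of_finiteIndex (M L : Subgroup G) [Infinite M] [L.FiniteIndex] :
    Infinite (M ⊓ L : Subgroup G) := by
  refine not_finite_iff_infinite.1 fun h ↦ not_finite_iff_infinite.2 ‹Infinite M› ?_
  rw [(L.subgroupOf M).finite_iff_finite_and_finiteIndex]
  refine ⟨Finite.of_injective (fun x ↦ (⟨x.1.1, x.1.2, x.2⟩ : (M ⊓ L : Subgroup G)))
    fun x y hxy ↦ Subtype.ext (Subtype.ext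
      (congrArg (fun z : (M ⊓ L : Subgroup G) ↦ (z : G)) hxy)), inferInstance⟩

theorem finiteIndex_centralizer_of_finite_normal (N : Subgroup G) [N.Normal] [Finite N] :
    (Subgroup.centralizer (N : Set G)).FiniteIndex := by
  have : (MulAut.conjNormal (H := N)).ker = Subgroup.centralizer (N : Set G) := by
    ext g
    rw [MonoidHom.mem_ker, Subgroup.mem_centralizer_iff, MulEquiv.ext_iff, Subtype.forall]
    refine forall₂_congr fun x hx ↦ ?_
    rw [Subtype.ext_iff, MulAut.conjNormal_apply, MulAut.one_apply, mul_inv_eq_iff_eq_mul, eq_comm]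
  rw [← this]
  infer_instance

theorem finite_sup_of_normal (N K : Subgroup G) [K.Normal] [Finite N] [Finite K] :
    Finite (N ⊔ K : Subgroup G) := by
  have : ((N ⊔ K : Subgroup G) : Set G).Finite := by
    rw [Subgroup.mul_normal]
    exact Set.Finite.mul (Set.toFinite _) (Set.toFinite _)
  exact this

/-- The subgroup generated by the finite normal subgroups. -/
def finiteNormalRadical (G : Type*) [Group G] : Subgroup G where
  carrier := {x | ∃ N : Subgroup G, N.Normal ∧ Finite N ∧ x ∈ N}
  one_mem' := ⟨⊥, inferInstance, inferInstance, one_mem _⟩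
  inv_mem' := fun ⟨N, h, h', hx⟩ ↦ ⟨N, h, h', inv_mem hx⟩
  mul_mem' := fun ⟨N, _, _, hx⟩ ⟨K, _, _, hy⟩ ↦ ⟨N ⊔ K, inferInstance, finite_sup_of_normal N K,
    Subgroup.mul_mem_sup hx hy⟩

theorem isInfiniteNormal_finiteNormalRadical (h : HasLargeFiniteNormal G) :
    IsInfiniteNormal (finiteNormalRadical G) := by
  refine ⟨⟨fun x ⟨N, hN, hN', hx⟩ g ↦ ⟨N, hN, hN', hN.conj_mem x hx g⟩⟩,
    not_finite_iff_infinite.1 fun hfin ↦ ?_⟩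
  obtain ⟨N, hN, hN', hcard⟩ := h (Nat.card (finiteNormalRadical G) + 1)
  have hle : N ≤ finiteNormalRadical G := fun x hx ↦ ⟨N, hN, hN', hx⟩
  have := Subgroup.card_le_of_le hle
  omega

/-- If every element of `M` lies in a finite normal subgroup of `G`, then `M` is abelian as soon
as it is minimal among the infinite normal subgroups. -/
theorem commute_of_minimal_isInfiniteNormal {M : Subgroup G} (hM : Minimal IsInfiniteNormal M)
    (hfin : M ≤ finiteNormalRadical G) {x y : G} (hx : x ∈ M) (hy : y ∈ M) : x * y = y * x := by
  obtain ⟨N, hN, hN', hyN⟩ := hfin hy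
  have := hM.prop.1
  have := hM.prop.2
  have := finiteIndex_centralizer_of_finite_normal N
  have hle : M ≤ M ⊓ Subgroup.centralizer (N : Set G) :=
    hM.le_of_le ⟨inferInstance, infinite_inf_of_finiteIndex _ _⟩ inf_le_left
  exact (Subgroup.mem_centralizer_iff.1 (hle hx).2 y hyN).symm

theorem finite_or_eq_top_of_minimal {M : Subgroup G} (hM : Minimal IsInfiniteNormal M)
    (A : Subgroup M) (hA : (A.map M.subtype).Normal) : Finite A ∨ A = ⊤ := by
  rw [or_iff_not_imp_left, not_finite_iff_infinite]
  intro hinf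
  have hle : M ≤ A.map M.subtype := by
    refine hM.le_of_le ⟨hA, ?_⟩ (Subgroup.map_subtype_le A)
    exact Infinite.of_injective _
      (Subgroup.equivMapOfInjective A M.subtype M.subtype_injective).injective
  refine eq_top_iff.2 fun x _ ↦ ?_
  obtain ⟨y, hy, hyx⟩ := hle x.2
  rwa [← Subtype.ext hyx]

end FiniteIndex

/-! ### Transitive normal subgroups and point stabilisers. -/

section Action

variable {G Ω : Type*} [Group G] [MulAction G Ω]

theorem exists_mul_stabilizer {N : Subgroup G} [MulAction.IsPretransitive N Ω] (α : Ω) (g : G) :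
    ∃ n ∈ N, ∃ h ∈ MulAction.stabilizer G α, g = n * h := by
  obtain ⟨n, hn⟩ := MulAction.exists_smul_eq N α (g • α)
  refine ⟨n, n.2, (n : G)⁻¹ * g, ?_, by group⟩
  rw [MulAction.mem_stabilizer_iff, mul_smul, ← hn]
  exact inv_smul_smul (n : G) α

/-- If `N ≤ M` are infinite normal with the same trace on the stabiliser, factor `x ∈ M` as `n * h`:
then `h` lies in the trace of `M`, so in `N`. -/
theorem exists_minimal_isInfiniteNormal_le
    (hG : ∀ N : Subgroup G, IsInfiniteNormal N → MulAction.IsPretransitive N Ω) {α : Ω}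
    (hH : MinN (MulAction.stabilizer G α)) {K : Subgroup G} (hK : IsInfiniteNormal K) :
    ∃ M ≤ K, Minimal IsInfiniteNormal M := by
  obtain ⟨L, ⟨M, ⟨hMK, hM⟩, rfl⟩, hmin⟩ := hH
    ((fun N ↦ N.subgroupOf (MulAction.stabilizer G α)) '' {N | N ≤ K ∧ IsInfiniteNormal N})
    ⟨_, K, ⟨le_rfl, hK⟩, rfl⟩ (by
      rintro _ ⟨N, ⟨-, hN, -⟩, rfl⟩
      exact hN.subgroupOf _)
  refine ⟨M, hMK, hM, fun N hN hNM x hx ↦ ?_⟩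
  have := hG N hN
  have hle := hmin ⟨N, ⟨hNM.trans hMK, hN⟩, rfl⟩ (Subgroup.comap_mono hNM)
  obtain ⟨n, hn, h, hh, rfl⟩ := exists_mul_stabilizer (N := N) α x
  exact mul_mem hn (@hle ⟨h, hh⟩ ((mul_mem_cancel_left (hNM hn)).1 hx))

theorem finiteIndex_of_finite_stabilizer {α : Ω} [Finite (MulAction.stabilizer G α)]
    {M : Subgroup G} [MulAction.IsPretransitive M Ω] : M.FiniteIndex := by
  have : Finite (G ⧸ M) := by
    refine Finite.of_surjective
      (fun h : MulAction.stabilizer G α ↦ (((h : G)⁻¹ : G) : G ⧸ M)) fun x ↦ ?_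
    induction x using QuotientGroup.induction_on with
    | H g =>
      -- Factoring `g⁻¹` rather than `g` puts the stabiliser factor on the left, as left cosets of
      -- `M` require.
      obtain ⟨n, hn, h, hh, hg⟩ := exists_mul_stabilizer (N := M) α g⁻¹
      refine ⟨⟨h, hh⟩, ?_⟩
      rw [← inv_inv g, hg, QuotientGroup.eq]
      simpa using inv_mem hn
  exact Subgroup.finiteIndex_of_finite_quotient

variable [FaithfulSMul G Ω]

theorem eq_one_of_commute_of_mem_stabilizer {M : Subgroup G} [MulAction.IsPretransitive M Ω]
    {α : Ω} {h : G} (hh : h ∈ MulAction.stabilizer G α) (hc : ∀ m ∈ M, m * h = h * m) :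
    h = 1 := by
  refine FaithfulSMul.eq_of_smul_eq_smul (α := Ω) fun β ↦ ?_
  obtain ⟨m, rfl⟩ := MulAction.exists_smul_eq M α β
  change h • (m : G) • α = (1 : G) • (m : G) • α
  rw [← mul_smul, ← hc m m.2, mul_smul, MulAction.mem_stabilizer_iff.1 hh, one_smul]

theorem actsRegularly_of_commute {M : Subgroup G} [MulAction.IsPretransitive M Ω]
    (hc : ∀ x ∈ M, ∀ y ∈ M, x * y = y * x) : ActsRegularly M Ω := by
  intro a b
  obtain ⟨m, hm⟩ := MulAction.exists_smul_eq M a b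
  refine ⟨m, hm, fun n hn ↦ ?_⟩
  have h : (m : G)⁻¹ * n = 1 := by
    refine eq_one_of_commute_of_mem_stabilizer (M := M) (α := a) ?_
      fun x hx ↦ hc _ hx _ (mul_mem (inv_mem m.2) n.2)
    rw [MulAction.mem_stabilizer_iff, mul_smul, inv_smul_eq_iff]
    exact hn.trans hm.symm
  exact Subtype.ext (inv_mul_eq_one.1 h).symm

theorem finite_stabilizer_of_le_finiteNormalRadical {α : Ω}
    (hH : MinN (MulAction.stabilizer G α)) {M : Subgroup G} [MulAction.IsPretransitive M Ω]
    (hfin : M ≤ finiteNormalRadical G) : Finite (MulAction.stabilizer G α) := by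
  set H := MulAction.stabilizer G α
  obtain ⟨L, ⟨N, ⟨hN, hN'⟩, rfl⟩, hmin⟩ := hH
    ((fun N : Subgroup G ↦ (Subgroup.centralizer (N : Set G)).subgroupOf H) ''
      {N | N.Normal ∧ Finite N})
    ⟨_, ⊥, ⟨inferInstance, inferInstance⟩, rfl⟩ (by
      rintro _ ⟨N, ⟨hN, -⟩, rfl⟩
      exact Subgroup.Normal.subgroupOf inferInstance _)
  -- Enlarging `N` by a finite normal `K` cannot shrink the minimal trace, so that trace centralises
  -- every such `K`, hence `M`, and is trivial.
  have hbot : (Subgroup.centralizer (N : Set G)).subgroupOf H = ⊥ := by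
    refine (Subgroup.eq_bot_iff_forall _).2 fun h hh ↦ Subtype.ext ?_
    refine eq_one_of_commute_of_mem_stabilizer (M := M) h.2 fun m hm ↦ ?_
    obtain ⟨K, hK, hK', hmK⟩ := hfin hm
    have hle := hmin ⟨N ⊔ K, ⟨inferInstance, finite_sup_of_normal N K⟩, rfl⟩
      (Subgroup.comap_mono (Subgroup.centralizer_le (SetLike.coe_subset_coe.2 le_sup_left))) hh
    exact Subgroup.mem_centralizer_iff.1 hle m (Subgroup.mem_sup_right hmK)
  have := finiteIndex_centralizer_of_finite_normal N
  rw [Subgroup.finite_iff_finite_and_finiteIndex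
    ((Subgroup.centralizer (N : Set G)).subgroupOf H)]
  refine ⟨?_, inferInstance⟩
  rw [hbot]
  infer_instance

end Action

/-! ### Abelian torsion groups with few characteristic subgroups. -/

section Abelian

/-- The subgroup is the kernel of a nonzero linear functional to `ZMod p`. -/
theorem exists_finiteIndex_lt_top_of_pow_eq_one {C : Type*} [CommGroup C] [Nontrivial C] {p : ℕ}
    [Fact p.Prime] (h : ∀ x : C, x ^ p = 1) : ∃ U : Subgroup C, U.FiniteIndex ∧ U < ⊤ := by
  let : Module (ZMod p) (Additive C) := AddCommGroup.zmodModule (n := p) (G := Additive C) h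
  obtain ⟨x, hx⟩ := exists_ne (0 : Additive C)
  obtain ⟨f, hf⟩ : ∃ f : Module.Dual (ZMod p) (Additive C), f x ≠ 0 := by
    by_contra! hcon
    exact hx ((Module.forall_dual_apply_eq_zero_iff (ZMod p) x).1 hcon)
  let g : C →* Multiplicative (ZMod p) := AddMonoidHom.toMultiplicativeRight f.toAddMonoidHom
  refine ⟨g.ker, inferInstance, lt_top_iff_ne_top.2 fun htop ↦ hf ?_⟩
  have : x.toMul ∈ g.ker := htop ▸ Subgroup.mem_top _
  exact this

/-- The elements of `p`-power order. -/
def primaryPart (p : ℕ) (C : Type*) [CommGroup C] : Subgroup C where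
  carrier := {x | ∃ n : ℕ, x ^ p ^ n = 1}
  one_mem' := ⟨0, one_pow _⟩
  inv_mem' := fun ⟨n, hn⟩ ↦ ⟨n, by rw [inv_pow, hn, inv_one]⟩
  mul_mem' := fun ⟨m, hm⟩ ⟨n, hn⟩ ↦ ⟨m + n, by
    rw [mul_pow, pow_add, pow_mul, hm, one_pow, mul_comm (p ^ m), pow_mul, hn, one_pow, one_mul]⟩

theorem primaryPart_characteristic (p : ℕ) (C : Type*) [CommGroup C] :
    (primaryPart p C).Characteristic :=
  Subgroup.characteristic_iff_le_comap.2 fun φ x ⟨n, hn⟩ ↦ ⟨n, by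
    change φ x ^ p ^ n = 1
    rw [← map_pow, hn, map_one]⟩

theorem ker_powMonoidHom_characteristic (n : ℕ) (C : Type*) [CommGroup C] :
    (powMonoidHom n : C →* C).ker.Characteristic :=
  Subgroup.characteristic_iff_le_comap.2 fun φ x hx ↦ by
    change φ x ^ n = 1
    rw [← map_pow, show x ^ n = 1 from hx, map_one]

theorem range_powMonoidHom_characteristic (n : ℕ) (C : Type*) [CommGroup C] :
    (powMonoidHom n : C →* C).range.Characteristic :=
  Subgroup.characteristic_iff_le_comap.2 fun φ x ⟨y, hy⟩ ↦ ⟨φ y, by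
    rw [← hy]
    exact (map_pow φ y n).symm⟩

/-- An infinite abelian torsion group without infinite proper characteristic subgroups is either
of prime exponent or a divisible `p`-group of finite rank. -/
theorem exists_isDivisibleAbelianPGroup {C : Type*} [CommGroup C] [Infinite C]
    (htors : ∀ x : C, IsOfFinOrder x)
    (hchar : ∀ A : Subgroup C, A.Characteristic → Finite A ∨ A = ⊤)
    (hexp : ∀ p : ℕ, p.Prime → ∃ x : C, x ^ p ≠ 1) :
    ∃ p : ℕ, p.Prime ∧ ∃ r : ℕ, IsDivisibleAbelianPGroup p r C := by
  have hker (p : ℕ) (hp : p.Prime) : Finite (powMonoidHom p : C →* C).ker := by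
    refine (hchar _ (ker_powMonoidHom_characteristic p C)).resolve_right fun htop ↦ ?_
    obtain ⟨x, hx⟩ := hexp p hp
    exact hx (show x ∈ (powMonoidHom p : C →* C).ker from htop ▸ Subgroup.mem_top x)
  have hsurj (p : ℕ) (hp : p.Prime) (x : C) : ∃ y, y ^ p = x := by
    have := hker p hp
    obtain hfin | htop := hchar _ (range_powMonoidHom_characteristic p C)
    · exact (not_finite_iff_infinite.2 ‹Infinite C›
        ((powMonoidHom p : C →* C).finite_iff_finite_ker_range.2 ⟨this, hfin⟩)).elim
    · exact (show x ∈ (powMonoidHom p : C →* C).range from htop ▸ Subgroup.mem_top x)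
  have hdiv (n : ℕ) (hn : n ≠ 0) : ∀ x : C, ∃ y, y ^ n = x := by
    induction n using Nat.recOnMul with
    | zero => exact absurd rfl hn
    | one => exact fun x ↦ ⟨x, pow_one x⟩
    | prime p hp => exact hsurj p hp
    | mul a b ha hb =>
      intro x
      obtain ⟨y, rfl⟩ := hb (right_ne_zero_of_mul hn) x
      obtain ⟨z, rfl⟩ := ha (left_ne_zero_of_mul hn) y
      exact ⟨z, pow_mul z a b⟩
  obtain ⟨x, hx⟩ := exists_ne (1 : C)
  have hox : orderOf x ≠ 1 := fun h ↦ hx (orderOf_eq_one_iff.1 h)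
  obtain ⟨p, hp, hpx⟩ := Nat.exists_prime_and_dvd hox
  have hfact : Fact p.Prime := ⟨hp⟩
  have hy : orderOf (x ^ (orderOf x / p)) = p :=
    orderOf_pow_orderOf_div (htors x).orderOf_pos.ne' hpx
  set y := x ^ (orderOf x / p)
  have hyp : y ^ p = 1 := by rw [← hy, pow_orderOf_eq_one]
  have hy1 : y ≠ 1 := fun h ↦ hp.ne_one (by rw [← hy, h, orderOf_one])
  have htop : primaryPart p C = ⊤ := by
    refine (hchar _ (primaryPart_characteristic p C)).resolve_left fun hfin ↦ hy1 ?_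
    -- On a finite primary part this surjective map would be injective, yet it sends `y ≠ 1` to `1`.
    have hs : Function.Surjective (fun z : primaryPart p C ↦ z ^ p) := by
      rintro ⟨z, n, hn⟩
      obtain ⟨w, rfl⟩ := hsurj p hp z
      exact ⟨⟨w, n + 1, by rw [pow_succ', pow_mul, hn]⟩, rfl⟩
    have hi := Finite.injective_iff_surjective.2 hs
    have := @hi ⟨y, 1, by rwa [pow_one]⟩ 1 (Subtype.ext (by simpa using hyp))
    exact congrArg Subtype.val this
  have hkp := hker p hp
  have hP : IsPGroup p (powMonoidHom p : C →* C).ker :=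
    fun z ↦ ⟨1, Subtype.ext (by rw [pow_one]; exact z.2)⟩
  obtain ⟨r, hr⟩ := IsPGroup.iff_card.1 hP
  exact ⟨p, hp, r, mul_comm, fun z ↦ (htop ▸ Subgroup.mem_top z : z ∈ primaryPart p C), hdiv, hr⟩

end Abelian

/-! ### From invariant subgroups to invariant subspaces. -/

section Irreducible

theorem Padic.eq_zero_of_forall_norm_div_pow_le {p : ℕ} [Fact p.Prime] {x : ℚ_[p]} {c : ℝ}
    (h : ∀ n : ℕ, ‖x / (p : ℚ_[p]) ^ n‖ ≤ c) : x = 0 := by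
  by_contra hx
  have hx' : 0 < ‖x‖ := norm_pos_iff.2 hx
  obtain ⟨n, hn⟩ := pow_unbounded_of_one_lt (c / ‖x‖)
    (show (1 : ℝ) < p from Nat.one_lt_cast.2 (Fact.out : p.Prime).one_lt)
  have := h n
  rw [norm_div, norm_pow, Padic.norm_p, inv_pow, div_inv_eq_mul] at this
  rw [div_lt_iff₀ hx'] at hn
  linarith [mul_comm ‖x‖ ((p : ℝ) ^ n)]

variable {p : ℕ} [Fact p.Prime] {r : ℕ}

theorem padicRepresentation_apply {H : Type*} [Group H]
    (ρ : H →* Matrix.GeneralLinearGroup (Fin r) ℤ_[p]) (h : H) (v : Fin r → ℚ_[p]) (i : Fin r) :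
    padicRepresentation ρ h v i =
      ∑ j, ((ρ h : Matrix (Fin r) (Fin r) ℤ_[p]) i j : ℚ_[p]) * v j :=
  rfl

/-- The coordinatewise projection `ℚ_p ^ r → (ℚ_p / ℤ_p) ^ r`. -/
noncomputable def PruferGroup.piMk (p : ℕ) [Fact p.Prime] (r : ℕ) :
    (Fin r → ℚ_[p]) →+ (Fin r → PruferGroup p) :=
  (LinearMap.compLeft (Submodule.mkQ (LinearMap.range (Algebra.linearMap ℤ_[p] ℚ_[p])))
    (Fin r)).toAddMonoidHom

theorem PruferGroup.piMk_apply (v : Fin r → ℚ_[p]) (i : Fin r) :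
    PruferGroup.piMk p r v i = Submodule.Quotient.mk (v i) :=
  rfl

theorem PruferGroup.piMk_surjective : Function.Surjective (PruferGroup.piMk p r) := by
  intro x
  choose v hv using fun i ↦ Submodule.Quotient.mk_surjective _ (x i)
  exact ⟨v, funext hv⟩

theorem PruferGroup.piMk_eq_zero_iff {v : Fin r → ℚ_[p]} :
    PruferGroup.piMk p r v = 0 ↔ ∀ i, ‖v i‖ ≤ 1 := by
  rw [funext_iff]
  exact forall_congr' fun i ↦ PruferGroup.mk_eq_zero_iff (v i)

theorem PruferGroup.piMk_padicRepresentation {H : Type*} [Group H]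
    (ρ : H →* Matrix.GeneralLinearGroup (Fin r) ℤ_[p]) (h : H) (v : Fin r → ℚ_[p]) (i : Fin r) :
    PruferGroup.piMk p r (padicRepresentation ρ h v) i =
      ∑ j, (ρ h : Matrix (Fin r) (Fin r) ℤ_[p]) i j • PruferGroup.piMk p r v j := by
  simp_rw [piMk_apply, padicRepresentation_apply]
  rw [← Submodule.mkQ_apply, map_sum]
  rfl

/-- A subspace of `ℚ_p ^ r` with finite image in `(ℚ_p / ℤ_p) ^ r` is zero. -/
theorem eq_bot_of_finite_image_piMk {W : Submodule ℚ_[p] (Fin r → ℚ_[p])}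
    (h : (PruferGroup.piMk p r '' W).Finite) : W = ⊥ := by
  let A := W.toAddSubgroup.map (PruferGroup.piMk p r)
  have : Finite A := h
  have hint (w) (hw : w ∈ W) : ∀ i, ‖w i‖ ≤ 1 := by
    have hc : (Nat.card A : ℚ_[p]) ≠ 0 := Nat.cast_ne_zero.2 Nat.card_pos.ne'
    rw [← PruferGroup.piMk_eq_zero_iff]
    -- Dividing by `|A|` stays in `W`, and multiplying back by `|A|` annihilates the image, so `w`
    -- itself is integral.
    let a : A := ⟨PruferGroup.piMk p r ((Nat.card A : ℚ_[p])⁻¹ • w), _, W.smul_mem _ hw, rfl⟩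
    have ha : Nat.card A • a = 0 := card_nsmul_eq_zero'
    have ha' := congrArg Subtype.val ha
    change Nat.card A • PruferGroup.piMk p r _ = 0 at ha'
    rwa [← map_nsmul, ← Nat.cast_smul_eq_nsmul ℚ_[p], smul_smul, mul_inv_cancel₀ hc,
      one_smul] at ha'
  refine (Submodule.eq_bot_iff _).2 fun w hw ↦ funext fun i ↦ ?_
  refine Padic.eq_zero_of_forall_norm_div_pow_le (c := 1) fun n ↦ ?_
  have := hint _ (W.smul_mem ((p : ℚ_[p]) ^ n)⁻¹ hw) i
  rwa [Pi.smul_apply, smul_eq_mul, inv_mul_eq_div] at this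

/-- A subspace of `ℚ_p ^ r` that maps onto `(ℚ_p / ℤ_p) ^ r` is the whole space. -/
theorem eq_top_of_image_piMk {W : Submodule ℚ_[p] (Fin r → ℚ_[p])}
    (h : ∀ x, ∃ w ∈ W, PruferGroup.piMk p r w = x) : W = ⊤ := by
  by_contra hW
  obtain ⟨f, hf, hWf⟩ := Submodule.exists_le_ker_of_lt_top W (lt_top_iff_ne_top.2 hW)
  -- Modulo `ℤ_p ^ r`, `u` agrees with some `w ∈ W`, where `f` vanishes. Hence `f u` is the value of
  -- `f` at an integral vector, bounded independently of `u`; scaling `u` by powers of `1 / p` then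
  -- forces `f = 0`.
  have hbound (u : Fin r → ℚ_[p]) : ‖f u‖ ≤ ∑ i, ‖f (Pi.single i 1)‖ := by
    obtain ⟨w, hw, hwu⟩ := h (PruferGroup.piMk p r u)
    have hz : ∀ i, ‖(u - w) i‖ ≤ 1 := by
      rw [← PruferGroup.piMk_eq_zero_iff, map_sub, hwu, sub_self]
    have hfu : f u = f (u - w) := by
      rw [map_sub, LinearMap.mem_ker.1 (hWf hw), sub_zero]
    rw [hfu, LinearMap.pi_apply_eq_sum_univ f (u - w)]
    refine (norm_sum_le _ _).trans (Finset.sum_le_sum fun i _ ↦ ?_)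
    rw [norm_smul]
    have hsingle : (fun j ↦ if i = j then (1 : ℚ_[p]) else 0) = Pi.single i 1 := by
      ext j
      simp [Pi.single_apply, eq_comm]
    rw [hsingle]
    exact mul_le_of_le_one_left (norm_nonneg _) (hz i)
  refine hf (LinearMap.ext fun u ↦ ?_)
  refine Padic.eq_zero_of_forall_norm_div_pow_le (c := ∑ i, ‖f (Pi.single i 1)‖) fun n ↦ ?_
  have := hbound (((p : ℚ_[p]) ^ n)⁻¹ • u)
  rwa [map_smul, smul_eq_mul, inv_mul_eq_div] at this

/-- If every `H`-invariant subgroup of `M` is finite or all of `M`, then `H` is irreducible over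
`ℚ_p`. -/
theorem padicRepresentation_isIrreducible {H M : Type*} [Group H] [Group M] [Infinite M]
    {φ : H →* MulAut M} (hinv : ∀ A : Subgroup M, (∀ h, ∀ x ∈ A, φ h x ∈ A) → Finite A ∨ A = ⊤)
    (e : Additive M ≃+ (Fin r → PruferGroup p))
    {ρ : H →* Matrix.GeneralLinearGroup (Fin r) ℤ_[p]}
    (hρ : ∀ h : H, IsMatrixOf e (φ h) (ρ h : Matrix (Fin r) (Fin r) ℤ_[p])) :
    (padicRepresentation ρ).IsIrreducible := by
  have hne : (⊥ : Subrepresentation (padicRepresentation ρ)) ≠ ⊤ := by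
    intro h
    have h0 (v : Fin r → ℚ_[p]) : v = 0 := by
      have hv : v ∈ (⊤ : Subrepresentation (padicRepresentation ρ)).toSubmodule :=
        Submodule.mem_top
      rw [← h] at hv
      exact (Submodule.mem_bot _).1 hv
    have : Subsingleton (Fin r → PruferGroup p) := by
      refine subsingleton_of_forall_eq 0 fun x ↦ ?_
      obtain ⟨v, rfl⟩ := PruferGroup.piMk_surjective x
      rw [h0 v, map_zero]
    have : Infinite (Fin r → PruferGroup p) :=
      Infinite.of_injective (fun x : M ↦ e (Additive.ofMul x))
        (e.injective.comp Additive.ofMul.injective)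
    exact not_finite (Fin r → PruferGroup p)
  refine { exists_pair_ne := ⟨⊥, ⊤, hne⟩, eq_bot_or_eq_top := fun W ↦ ?_ }
  let A : Subgroup M := AddSubgroup.toSubgroup'
    ((W.toSubmodule.toAddSubgroup.map (PruferGroup.piMk p r)).comap e.toAddMonoidHom)
  have hmem (x : M) :
      x ∈ A ↔ ∃ w ∈ W.toSubmodule, PruferGroup.piMk p r w = e (Additive.ofMul x) := Iff.rfl
  have hA : ∀ h, ∀ x ∈ A, φ h x ∈ A := by
    intro h x hx
    obtain ⟨w, hw, hwx⟩ := (hmem x).1 hx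
    refine (hmem _).2 ⟨_, W.apply_mem_toSubmodule h hw, funext fun i ↦ ?_⟩
    rw [PruferGroup.piMk_padicRepresentation, hρ h x i, hwx]
  obtain hfin | htop := hinv A hA
  · left
    refine Subrepresentation.toSubmodule_injective (eq_bot_of_finite_image_piMk ?_)
    refine ((Set.toFinite (A : Set M)).image fun x ↦ e (Additive.ofMul x)).subset ?_
    rintro _ ⟨w, hw, rfl⟩
    refine ⟨(e.symm (PruferGroup.piMk p r w)).toMul, (hmem _).2 ⟨w, hw, ?_⟩, ?_⟩
    · exact (e.apply_symm_apply _).symm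
    · exact e.apply_symm_apply _
  · right
    refine Subrepresentation.toSubmodule_injective (eq_top_of_image_piMk fun x ↦ ?_)
    obtain ⟨w, hw, hwx⟩ := (hmem (e.symm x).toMul).1 (htop ▸ Subgroup.mem_top _)
    exact ⟨w, hw, hwx.trans (e.apply_symm_apply x)⟩

end Irreducible

/-! ### Coordinates, uniqueness and the main theorem. -/

theorem nonempty_addEquiv_pruferGroup {p : ℕ} [Fact p.Prime] {r : ℕ} {C : Type*} [CommGroup C]
    (h : IsDivisibleAbelianPGroup p r C) : Nonempty (Additive C ≃+ (Fin r → PruferGroup p)) := by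
  have hcard : Nat.card {x : Additive C // p • x = 0} = p ^ r := h.rank_eq
  have : Finite {x : Additive C // p • x = 0} := Nat.finite_of_card_ne_zero
    (hcard ▸ pow_ne_zero _ (Fact.out : p.Prime).ne_zero)
  exact nonempty_addEquiv_of_card_torsion_eq (p := p) h.divisible
    (fun n hn ↦ PruferGroup.pi_exists_nsmul_eq hn) h.isPGroup
    PruferGroup.pi_exists_pow_smul_eq_zero (hcard.trans PruferGroup.natCard_pi_torsion.symm)

section Main

variable {G : Type*} [Group G]

/-- Exponent `p` would give `M` a proper subgroup of finite index. It has finite index in `G` too,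
so its normal core is infinite, against minimality. -/
theorem exists_pow_ne_one_of_minimal {M : Subgroup G} (hM : Minimal IsInfiniteNormal M)
    [M.FiniteIndex] (hc : ∀ x y : M, x * y = y * x) {p : ℕ} (hp : p.Prime) :
    ∃ x : M, x ^ p ≠ 1 := by
  by_contra! h
  have := hM.prop.2
  have : Fact p.Prime := ⟨hp⟩
  let : CommGroup M := { mul_comm := hc }
  obtain ⟨U, hU, hlt⟩ := exists_finiteIndex_lt_top_of_pow_eq_one h
  have hUG : (U.map M.subtype).FiniteIndex := by
    rw [Subgroup.finiteIndex_iff, Subgroup.index_map_subtype]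
    exact mul_ne_zero hU.index_ne_zero Subgroup.FiniteIndex.index_ne_zero
  have hle : (U.map M.subtype).normalCore ≤ M :=
    (Subgroup.normalCore_le _).trans (Subgroup.map_subtype_le U)
  have hinf := infinite_inf_of_finiteIndex M (U.map M.subtype).normalCore
  rw [inf_eq_right.2 hle] at hinf
  have hMU := (hM.le_of_le ⟨Subgroup.normalCore_normal _, hinf⟩ hle).trans
    (Subgroup.normalCore_le _)
  refine hlt.ne (eq_top_iff.2 fun x _ ↦ ?_)
  obtain ⟨y, hy, hyx⟩ := hMU x.2
  rwa [← Subtype.ext hyx]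

theorem eq_of_minimal_isInfiniteNormal {M N : Subgroup G} (hM : Minimal IsInfiniteNormal M)
    [M.FiniteIndex] (hN : Minimal IsInfiniteNormal N) : N = M := by
  have := hM.prop.1
  have := hN.prop.1
  have := hN.prop.2
  have h : IsInfiniteNormal (N ⊓ M) := ⟨inferInstance, infinite_inf_of_finiteIndex _ _⟩
  exact (hN.eq_of_le h inf_le_left).symm.trans (hM.eq_of_le h inf_le_right)

/-- In `g = m * h` the factor `m` acts trivially on the abelian group `M`, so invariance under the
stabiliser suffices. -/
theorem map_subtype_normal_of_conj_mem {Ω : Type*} [MulAction G Ω] {M : Subgroup G} [M.Normal]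
    [MulAction.IsPretransitive M Ω] (hc : ∀ x y : M, x * y = y * x) {α : Ω} {A : Subgroup M}
    (hA : ∀ h : MulAction.stabilizer G α, ∀ x ∈ A, MulAut.conjNormal (h : G) x ∈ A) :
    (A.map M.subtype).Normal := by
  refine ⟨?_⟩
  rintro _ ⟨x, hx, rfl⟩ g
  obtain ⟨m, hm, h, hh, rfl⟩ := exists_mul_stabilizer (N := M) α g
  refine ⟨_, hA ⟨h, hh⟩ x hx, ?_⟩
  have hcomm := congrArg Subtype.val (hc ⟨m, hm⟩ (MulAut.conjNormal h x))
  simp only [Subgroup.coe_mul, MulAut.conjNormal_apply] at hcomm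
  simp only [Subgroup.coe_subtype, MulAut.conjNormal_apply]
  rw [mul_inv_rev, eq_comm]
  calc m * h * x * (h⁻¹ * m⁻¹) = m * (h * x * h⁻¹) * m⁻¹ := by group
    _ = h * x * h⁻¹ := by rw [hcomm, mul_inv_cancel_right]

end Main

theorem mainTheorem3 {Ω : Type*} [Infinite Ω] (G : Subgroup (Equiv.Perm Ω))
    (hG : ∀ N : Subgroup G, IsInfiniteNormal N → MulAction.IsPretransitive N Ω)
    (α : Ω) (hH : MinN (MulAction.stabilizer G α))
    (hlarge : HasLargeFiniteNormal G) :
    ∃ M : Subgroup G,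
      (Minimal IsInfiniteNormal M ∧ ∀ N : Subgroup G, Minimal IsInfiniteNormal N → N = M) ∧
      ActsRegularly M Ω ∧
      Finite (MulAction.stabilizer G α) ∧
      ∃ (_ : M.Normal) (p : ℕ) (_ : Fact p.Prime) (r : ℕ),
        IsDivisibleAbelianPGroup p r M ∧
        Function.Injective
          ((MulAut.conjNormal (H := M)).comp (MulAction.stabilizer G α).subtype) ∧
        IsPAdicIrreducible p r
          ((MulAut.conjNormal (H := M)).comp (MulAction.stabilizer G α).subtype) := by
  obtain ⟨M, hfin, hM⟩ := exists_minimal_isInfiniteNormal_le hG hH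
    (isInfiniteNormal_finiteNormalRadical hlarge)
  have hMn := hM.prop.1
  have hMi := hM.prop.2
  have htrans := hG M hM.prop
  have hcomm : ∀ x ∈ M, ∀ y ∈ M, x * y = y * x :=
    fun x hx y hy ↦ commute_of_minimal_isInfiniteNormal hM hfin hx hy
  have hcomm' : ∀ x y : M, x * y = y * x := fun x y ↦ Subtype.ext (hcomm x x.2 y y.2)
  have hHfin := finite_stabilizer_of_le_finiteNormalRadical hH hfin
  have hindex : M.FiniteIndex := finiteIndex_of_finite_stabilizer (α := α)
  let hCG : CommGroup M := { mul_comm := hcomm' }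
  obtain ⟨p, hp, r, hpr⟩ := exists_isDivisibleAbelianPGroup (C := M)
    (fun x ↦ by
      obtain ⟨N, -, hN, hxN⟩ := hfin x.2
      have h : IsOfFinOrder (x : G) :=
        N.subtype.isOfFinOrder (isOfFinOrder_of_finite (⟨x, hxN⟩ : N))
      exact Submonoid.isOfFinOrder_coe.1 h)
    -- A characteristic subgroup of the normal subgroup `M` is normal in `G`.
    (fun A _ ↦ finite_or_eq_top_of_minimal hM A inferInstance)
    (fun p hp ↦ exists_pow_ne_one_of_minimal hM hcomm' hp)
  have hfact : Fact p.Prime := ⟨hp⟩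
  refine ⟨M, ⟨hM, fun N hN ↦ eq_of_minimal_isInfiniteNormal hM hN⟩,
    actsRegularly_of_commute hcomm, hHfin, hMn, p, hfact, r, hpr, ?_, ?_, fun e ↦ ?_⟩
  · rw [injective_iff_map_eq_one]
    intro h hh
    refine Subtype.ext (eq_one_of_commute_of_mem_stabilizer (M := M) h.2 fun m hm ↦ ?_)
    have h1 := congrArg Subtype.val (DFunLike.congr_fun hh ⟨m, hm⟩)
    rw [MonoidHom.comp_apply, MulAut.conjNormal_apply, MulAut.one_apply,
      mul_inv_eq_iff_eq_mul] at h1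
    exact h1.symm
  · exact nonempty_addEquiv_pruferGroup hpr
  · obtain ⟨ρ, hρ⟩ := exists_hom_isMatrixOf
      ((MulAut.conjNormal (H := M)).comp (MulAction.stabilizer G α).subtype) e
    exact ⟨ρ, hρ, padicRepresentation_isIrreducible (fun A hA ↦ finite_or_eq_top_of_minimal hM A
      (map_subtype_normal_of_conj_mem hcomm' hA)) e hρ⟩
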